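/- For a Hermitian matrix $X\neq 0$, a positive semidefinite matrix $\sigma\neq 0$ and $\alpha\in[1,\infty)$, let $\mu_\alpha(X\Vert\sigma)=\big\Vert\sigma^{\frac{1-\alpha}{2\alpha}}X\sigma^{\frac{1-\alpha}{2\alpha}}\big\Vert_\alpha$ if $\operatorname{supp}X\subseteq\operatorname{supp}\sigma$ and $\mu_\alpha(X\Vert\sigma)=+\infty$ otherwise, where powers of $\sigma$ are taken on the support of $\sigma$ and $\Vert Y\Vert_\alpha=(\operatorname{Tr}|Y|^\alpha)^{1/\alpha}$ with $|Y|=\sqrt{Y^\dagger Y}$; for $\alpha=\infty$ the exponent is $-\tfrac12$ and the norm is the operator norm. Let $T_B$ denote the partial transpose on the second tensor factor and $\operatorname{PPT}(A{:}B)=\{\sigma:\sigma\ge 0,\ T_B(\sigma)\ge 0,\ \operatorname{Tr}\sigma=1\}$. The $\alpha$-logarithmic negativity of a bipartite quantum state $\rho$ (a positive semidefinite matrix of trace one) is $$E_N^\alpha(\rho)=\inf_{\sigma\in\operatorname{PPT}(A:B)}\log_2\mu_\alpha(T_B(\rho)\Vert\sigma).$$ Consider the two-qubit matrices $$\rho^1=\Phi^2=\tfrac12\sum_{i,j=0}^{1}|i\rangle\langle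 j|\otimes|i\rangle\langle j|,\qquad \rho^2=\tfrac12\big(|00\rangle\langle 00|+|11\rangle\langle 11|\big),\qquad \overline\rho=\tfrac12(\rho^1+\rho^2).$$ They are quantum states and, for every $\alpha\in[1,\infty]$, $$E_N^\alpha(\rho^1)=1,\qquad E_N^\alpha(\rho^2)=0,\qquad E_N^\alpha(\overline\rho)=\log_2\tfrac32,$$ so that $$E_N^\alpha(\overline\rho)>\tfrac12\big(E_N^\alpha(\rho^1)+E_N^\alpha(\rho^2)\big)=\tfrac12 .$$ In particular, for every $\alpha\in[1,\infty]$, the function $E_N^\alpha$ is not convex on the set of two-qubit states. -/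

import Mathlib

open scoped ENNReal Kronecker ComplexOrder

/-- The power `σ ^ s` of a positive semidefinite matrix, taken on the support of `σ`:
zero eigenvalues are sent to zero, whatever the sign of `s` (in particular `σ ^ 0` is the
projection onto the support). -/
noncomputable def supportPow {n : Type*} [Fintype n] [DecidableEq n]
    (σ : Matrix n n ℂ) (s : ℝ) : Matrix n n ℂ :=
  cfc (fun x : ℝ => if x = 0 then 0 else x ^ s) σ

/-- The absolute value `|Y| = √(Y† Y)`. -/
noncomputable def matrixAbs {n : Type*} [Fintype n] [DecidableEq n]
    (Y : Matrix n n ℂ) : Matrix n n ℂ :=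
  cfc Real.sqrt (Y.conjTranspose * Y)

/-- The `α`-norm `‖Y‖_α = (Tr |Y|^α)^(1/α)` for finite `α`; the operator norm for `α = ∞`. -/
noncomputable def alphaNorm {n : Type*} [Fintype n] [DecidableEq n]
    (α : ℝ≥0∞) (Y : Matrix n n ℂ) : ℝ :=
  if α = ⊤ then ‖Matrix.toEuclideanCLM (n := n) (𝕜 := ℂ) Y‖
  else (cfc (fun x : ℝ => x ^ α.toReal) (matrixAbs Y)).trace.re ^ (1 / α.toReal)

/-- The support of an operator: the orthogonal complement of its kernel. -/
noncomputable def matrixSupport {n : Type*} [Fintype n] [DecidableEq n]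
    (X : Matrix n n ℂ) : Submodule ℂ (EuclideanSpace ℂ n) :=
  (LinearMap.ker (Matrix.toEuclideanLin (𝕜 := ℂ) X))ᗮ

/-- The exponent `(1 - α) / (2 α)`, with its limit `-1/2` at `α = ∞`. -/
noncomputable def sandwichExponent (α : ℝ≥0∞) : ℝ :=
  if α = ⊤ then -1 / 2 else (1 - α.toReal) / (2 * α.toReal)

open Classical in
/-- `μ_α(X‖σ) = ‖σ^((1-α)/(2α)) X σ^((1-α)/(2α))‖_α` if `supp X ⊆ supp σ`, and `+∞` otherwise. -/
noncomputable def muAlpha {n : Type*} [Fintype n] [DecidableEq n]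
    (α : ℝ≥0∞) (X σ : Matrix n n ℂ) : ℝ≥0∞ :=
  if matrixSupport X ≤ matrixSupport σ then
    ENNReal.ofReal (alphaNorm α
      (supportPow σ (sandwichExponent α) * X * supportPow σ (sandwichExponent α)))
  else ⊤

/-- `ν_α(X‖σ) = log₂ μ_α(X‖σ)`, an extended real number. -/
noncomputable def nuAlpha {n : Type*} [Fintype n] [DecidableEq n]
    (α : ℝ≥0∞) (X σ : Matrix n n ℂ) : EReal :=
  ENNReal.log (muAlpha α X σ) / ((Real.log 2 : ℝ) : EReal)

/-- The partial transpose on the second tensor factor. -/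
def partialTranspose {a b : Type*} (Y : Matrix (a × b) (a × b) ℂ) :
    Matrix (a × b) (a × b) ℂ :=
  Matrix.of fun p q => Y (p.1, q.2) (q.1, p.2)

/-- Quantum states (density matrices). -/
def quantumStates (n : Type*) [Fintype n] : Set (Matrix n n ℂ) :=
  {ρ | ρ.PosSemidef ∧ ρ.trace = 1}

/-- Bipartite states whose partial transpose is positive semidefinite. -/
def pptStates (a b : Type*) [Fintype a] [Fintype b] : Set (Matrix (a × b) (a × b) ℂ) :=
  {σ | σ.PosSemidef ∧ (partialTranspose σ).PosSemidef ∧ σ.trace = 1}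

/-- The `α`-logarithmic negativity, `1 ≤ α ≤ ∞`. -/
noncomputable def logNegativity {a b : Type*} [Fintype a] [DecidableEq a] [Fintype b]
    [DecidableEq b] (α : ℝ≥0∞) (ρ : Matrix (a × b) (a × b) ℂ) : EReal :=
  ⨅ σ ∈ pptStates a b, nuAlpha α (partialTranspose ρ) σ

/-- Convexity of an extended-real-valued function on the set of quantum states. -/
def ConvexOnStates {n : Type*} [Fintype n] (f : Matrix n n ℂ → EReal) : Prop :=
  ∀ ρ ∈ quantumStates n, ∀ σ ∈ quantumStates n, ∀ t : ℝ, 0 ≤ t → t ≤ 1 →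
    f (t • ρ + (1 - t) • σ) ≤ (t : EReal) * f ρ + ((1 - t : ℝ) : EReal) * f σ

/-- The maximally entangled state `Φ^d = (1/d) ∑_{i,j} |i⟩⟨j| ⊗ |i⟩⟨j|`. -/
noncomputable def maxEntangled (d : ℕ) : Matrix (Fin d × Fin d) (Fin d × Fin d) ℂ :=
  (1 / d : ℝ) • ∑ i : Fin d, ∑ j : Fin d,
    (Matrix.single i j (1 : ℂ)) ⊗ₖ (Matrix.single i j (1 : ℂ))

/-- The state `(|00⟩⟨00| + |11⟩⟨11|) / 2`. -/
noncomputable def classicallyCorrelated : Matrix (Fin 2 × Fin 2) (Fin 2 × Fin 2) ℂ :=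
  (1 / 2 : ℝ) • (Matrix.single (0, 0) (0, 0) (1 : ℂ) + Matrix.single (1, 1) (1, 1) (1 : ℂ))

/-- The equal mixture of `Φ²` and `(|00⟩⟨00| + |11⟩⟨11|) / 2`. -/
noncomputable def equalMixture : Matrix (Fin 2 × Fin 2) (Fin 2 × Fin 2) ℂ :=
  (1 / 2 : ℝ) • (maxEntangled 2 + classicallyCorrelated)

/-! Write `X` for the partial transpose of `ρ` and `c` for its trace norm. For the three states here
`|X| / c` is PPT, and then the negativity is `log₂ c` for every `α`. Lower bound
(`re_trace_mul_le_alphaNorm`): let `Y` be the sandwiched operator and `u i` its eigenvectors. A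
Hermitian contraction `W` gives `Tr XW = ∑ λ i ⟨u i, T W T u i⟩` with `T² = σ ^ ((α-1)/α)`. Each
bracket is at most `⟨u i, T² u i⟩`, hence by Jensen at most `q i ^ ((α-1)/α)` with `q i = ⟨u i, σ u
i⟩`. Since `q` is a probability vector, Hölder leaves `‖Y‖_α`. The sign of `X` as `W` yields `c`.
Upper bound (`alphaNorm_le_of_mul_self_eq`): at `σ = |X| / c`, `|Y| = c σ ^ (1/α)` has `α`-norm `c`.
The partial transposes are weighted swaps with `c = 2, 1, 3/2`; convexity fails because `log₂ (3/2)
> 1/2`. -/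

namespace Matrix

/-! ### Functional calculus and support powers -/

variable {n : Type*} [Fintype n] [DecidableEq n]

/-- The spectrum is finite, so the calculus applies even to the powers in `supportPow`, which may be
discontinuous at 0. -/
theorem continuousOn_spectrum (f : ℝ → ℝ) (A : Matrix n n ℂ) : ContinuousOn f (spectrum ℝ A) :=
  A.finite_real_spectrum.continuousOn f

theorem IsHermitian.cfc_eq_mul {A : Matrix n n ℂ} (hA : A.IsHermitian) (f : ℝ → ℝ) :
    cfc f A = (hA.eigenvectorUnitary : Matrix n n ℂ) *
      diagonal (fun i => (f (hA.eigenvalues i) : ℂ)) *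
        star (hA.eigenvectorUnitary : Matrix n n ℂ) := by
  rw [hA.cfc_eq, IsHermitian.cfc, Unitary.conjStarAlgAut_apply]
  rfl

theorem IsHermitian.eq_mul {A : Matrix n n ℂ} (hA : A.IsHermitian) :
    A = (hA.eigenvectorUnitary : Matrix n n ℂ) *
      diagonal (fun i => (hA.eigenvalues i : ℂ)) *
        star (hA.eigenvectorUnitary : Matrix n n ℂ) := by
  conv_lhs => rw [hA.spectral_theorem, Unitary.conjStarAlgAut_apply]
  rfl

theorem IsHermitian.trace_cfc {A : Matrix n n ℂ} (hA : A.IsHermitian) (f : ℝ → ℝ) :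
    (cfc f A).trace = ((∑ i, f (hA.eigenvalues i) : ℝ) : ℂ) := by
  rw [hA.cfc_eq_mul, trace_mul_comm, ← mul_assoc, Unitary.coe_star_mul_self, one_mul,
    trace_diagonal]
  push_cast
  rfl

theorem IsHermitian.trace_mul_eq_sum {A : Matrix n n ℂ} (hA : A.IsHermitian)
    (M : Matrix n n ℂ) :
    (A * M).trace = ∑ i, (hA.eigenvalues i : ℂ) *
      (star (hA.eigenvectorUnitary : Matrix n n ℂ) * M *
        (hA.eigenvectorUnitary : Matrix n n ℂ)) i i := by
  conv_lhs => rw [hA.eq_mul, mul_assoc, mul_assoc, trace_mul_comm, mul_assoc]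
  simp only [trace, diag_apply, diagonal_mul, mul_assoc]

theorem IsHermitian.matrixAbs_eq {A : Matrix n n ℂ} (hA : A.IsHermitian) :
    matrixAbs A = cfc (fun x : ℝ => |x|) A := by
  have hA' : IsSelfAdjoint A := hA
  have h : Aᴴ * A = cfc (fun x : ℝ => x ^ 2) A := by
    rw [cfc_pow_id (R := ℝ) A 2, hA.eq, sq]
  rw [matrixAbs, h, ← cfc_comp' Real.sqrt (fun x : ℝ => x ^ 2) A
    ((A.finite_real_spectrum.image _).continuousOn _) (continuousOn_spectrum _ _)]
  simp only [Real.sqrt_sq_eq_abs]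

theorem IsHermitian.cfc_matrixAbs {A : Matrix n n ℂ} (hA : A.IsHermitian) (f : ℝ → ℝ) :
    cfc f (matrixAbs A) = cfc (fun x => f |x|) A := by
  have hA' : IsSelfAdjoint A := hA
  rw [hA.matrixAbs_eq, ← cfc_comp' f (fun x : ℝ => |x|) A
    ((A.finite_real_spectrum.image _).continuousOn _) (continuousOn_spectrum _ _)]

theorem IsHermitian.alphaNorm_eq {A : Matrix n n ℂ} (hA : A.IsHermitian) {α : ℝ≥0∞}
    (hα : α ≠ ⊤) :
    alphaNorm α A = (∑ i, |hA.eigenvalues i| ^ α.toReal) ^ (1 / α.toReal) := by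
  rw [alphaNorm, if_neg hα, hA.cfc_matrixAbs, hA.trace_cfc, Complex.ofReal_re]

theorem IsHermitian.abs_eigenvalues_le_norm {A : Matrix n n ℂ} (hA : A.IsHermitian) (i : n) :
    |hA.eigenvalues i| ≤ ‖toEuclideanCLM (n := n) (𝕜 := ℂ) A‖ := by
  have h := (toEuclideanCLM (n := n) (𝕜 := ℂ) A).le_opNorm (hA.eigenvectorBasis i)
  have h' : toEuclideanCLM (n := n) (𝕜 := ℂ) A (hA.eigenvectorBasis i) =
      hA.eigenvalues i • hA.eigenvectorBasis i := by
    ext j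
    simpa using congrFun (hA.mulVec_eigenvectorBasis i) j
  rw [h', norm_smul, hA.eigenvectorBasis.norm_eq_one] at h
  simpa using h

/-- Jensen's inequality for the diagonal entries, in an orthonormal basis, of a power of a
positive semidefinite matrix. -/
theorem PosSemidef.diag_conj_supportPow_le {σ : Matrix n n ℂ} (hσ : σ.PosSemidef)
    {U : Matrix n n ℂ} (hU : U ∈ unitaryGroup n ℂ) {p : ℝ} (hp0 : 0 ≤ p) (hp1 : p ≤ 1) (i : n) :
    ((star U * supportPow σ p * U) i i).re ≤ ((star U * σ * U) i i).re ^ p := by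
  set V : Matrix n n ℂ := (hσ.1.eigenvectorUnitary : Matrix n n ℂ)
  -- Diagonal entries in the basis `U` are averages of the spectrum with weights `|(U* V) i j|²`;
  -- taking `d = 1` shows that the weights sum to one.
  have key : ∀ d : n → ℝ, ((star U * (V * diagonal (fun j => (d j : ℂ)) * star V) * U) i i).re =
      ∑ j, Complex.normSq ((star U * V) i j) * d j := by
    intro d
    have : star U * (V * diagonal (fun j => (d j : ℂ)) * star V) * U =
        (star U * V) * diagonal (fun j => (d j : ℂ)) * star (star U * V) := by
      simp only [star_mul, star_star, mul_assoc]
    rw [this, mul_apply, Complex.re_sum]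
    refine Finset.sum_congr rfl fun j _ => ?_
    rw [mul_diagonal, star_apply, RCLike.star_def, mul_right_comm, Complex.mul_conj]
    norm_cast
  have hw : ∑ j, Complex.normSq ((star U * V) i j) = 1 := by
    have h := key 1
    have e : star U * (V * diagonal (fun j => (((1 : n → ℝ) j : ℝ) : ℂ)) * star V) * U = 1 := by
      simp only [Pi.one_apply, Complex.ofReal_one, diagonal_one, mul_one]
      rw [show V * star V = 1 from mem_unitaryGroup_iff.mp hσ.1.eigenvectorUnitary.2, mul_one]
      exact mem_unitaryGroup_iff'.mp hU
    rw [e] at h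
    simpa using h.symm
  have h0 := hσ.eigenvalues_nonneg
  conv_rhs => rw [hσ.1.eq_mul]
  rw [supportPow, hσ.1.cfc_eq_mul, key, key]
  -- Only an inequality: at `p = 0` a zero eigenvalue contributes 0 on the left but `0 ^ 0 = 1` on
  -- the right.
  refine le_trans (Finset.sum_le_sum fun j _ => mul_le_mul_of_nonneg_left
    (b := (if hσ.1.eigenvalues j = 0 then 0 else hσ.1.eigenvalues j ^ p))
    (c := hσ.1.eigenvalues j ^ p) ?_ (Complex.normSq_nonneg _)) ?_
  · split_ifs
    · exact Real.rpow_nonneg (h0 j) _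
    · exact le_rfl
  · simpa only [smul_eq_mul] using (Real.concaveOn_rpow hp0 hp1).le_map_sum
      (fun j _ => Complex.normSq_nonneg ((star U * V) i j)) hw (fun j _ => h0 j)

theorem isHermitian_supportPow (σ : Matrix n n ℂ) (s : ℝ) : (supportPow σ s).IsHermitian :=
  cfc_predicate _ _

theorem PosSemidef.spectrum_nonneg {σ : Matrix n n ℂ} (hσ : σ.PosSemidef) {x : ℝ}
    (hx : x ∈ spectrum ℝ σ) : 0 ≤ x := by
  rw [hσ.1.spectrum_real_eq_range_eigenvalues] at hx
  obtain ⟨i, rfl⟩ := hx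
  exact hσ.eigenvalues_nonneg i

theorem PosSemidef.supportPow_mul {σ : Matrix n n ℂ} (hσ : σ.PosSemidef) (s t : ℝ) :
    supportPow σ s * supportPow σ t = supportPow σ (s + t) := by
  rw [supportPow, supportPow, ← cfc_mul _ _ σ (continuousOn_spectrum _ _)
    (continuousOn_spectrum _ _)]
  refine cfc_congr fun x hx => ?_
  by_cases h : x = 0
  · simp [h]
  · simp [h, Real.rpow_add ((hσ.spectrum_nonneg hx).lt_of_ne' h)]

theorem PosSemidef.supportPow_one {σ : Matrix n n ℂ} (hσ : σ.PosSemidef) :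
    supportPow σ 1 = σ := by
  have h : supportPow σ 1 = cfc (id : ℝ → ℝ) σ :=
    cfc_congr fun x _ => by by_cases h : x = 0 <;> simp [h]
  exact h.trans (cfc_id ℝ σ (show IsSelfAdjoint σ from hσ.1))

theorem matrixSupport_le_iff {X σ : Matrix n n ℂ} :
    matrixSupport X ≤ matrixSupport σ ↔ ∀ v, σ *ᵥ v = 0 → X *ᵥ v = 0 := by
  rw [matrixSupport, matrixSupport, Submodule.orthogonal_le_orthogonal_iff]
  have key : ∀ (A : Matrix n n ℂ) (v : EuclideanSpace ℂ n),
      v ∈ LinearMap.ker (toEuclideanLin (𝕜 := ℂ) A) ↔ A *ᵥ v.ofLp = 0 := fun A v => by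
    rw [LinearMap.mem_ker, toLpLin_apply, WithLp.toLp_eq_zero]
  exact ⟨fun h v hv => (key _ (WithLp.toLp 2 v)).1 (h ((key _ _).2 hv)),
    fun h v hv => (key _ _).2 (h _ ((key _ _).1 hv))⟩

/-- `supportPow σ 0` is the support projection `P`. The columns of `P - 1` lie in the kernel of `σ`,
hence in that of `X`. -/
theorem PosSemidef.mul_supportPow_zero {X σ : Matrix n n ℂ} (hσ : σ.PosSemidef)
    (h : matrixSupport X ≤ matrixSupport σ) : X * supportPow σ 0 = X := by
  have h1 : σ * (supportPow σ 0 - 1) = 0 := by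
    have e := hσ.supportPow_mul 1 0
    rw [add_zero, hσ.supportPow_one] at e
    rw [mul_sub, e, mul_one, sub_self]
  rw [matrixSupport_le_iff] at h
  have h2 : X * (supportPow σ 0 - 1) = 0 := by
    ext i j
    have := h ((supportPow σ 0 - 1).col j) (funext fun k => congrFun (congrFun h1 k) j)
    exact congrFun this i
  rw [mul_sub, mul_one, sub_eq_zero] at h2
  exact h2

end Matrix

/-- Hölder: the second factor has unit norm in the conjugate exponent `p / (p - 1)`. The case `p =
1` is separate because its conjugate is infinite. -/
theorem Real.sum_mul_rpow_le_Lp {ι : Type*} [Fintype ι] {a q : ι → ℝ} (ha : ∀ i, 0 ≤ a i)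
    (hq : ∀ i, 0 ≤ q i) (hq1 : ∑ i, q i = 1) {p : ℝ} (hp : 1 ≤ p) :
    ∑ i, a i * q i ^ ((p - 1) / p) ≤ (∑ i, a i ^ p) ^ (1 / p) := by
  rcases hp.eq_or_lt with rfl | hp
  · simp
  · have h := Real.inner_le_Lp_mul_Lq_of_nonneg Finset.univ
      (Real.HolderConjugate.conjExponent hp) (fun i _ => ha i)
      (fun i _ => Real.rpow_nonneg (hq i) ((p - 1) / p))
    have e : ∀ i, (q i ^ ((p - 1) / p)) ^ p.conjExponent = q i := fun i => by
      rw [← Real.rpow_mul (hq i), Real.conjExponent, div_mul_div_cancel₀' (by linarith),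
        div_self (by linarith), Real.rpow_one]
    simpa only [e, hq1, Real.one_rpow, mul_one] using h

/-! ### The two bounds on the sandwiched norm -/

namespace Matrix

variable {n : Type*} [Fintype n] [DecidableEq n]

theorem isHermitian_supportPow_mul_mul {X : Matrix n n ℂ} (hX : X.IsHermitian)
    (σ : Matrix n n ℂ) (s : ℝ) : (supportPow σ s * X * supportPow σ s).IsHermitian := by
  have := isHermitian_conjTranspose_mul_mul (supportPow σ s) hX
  rwa [(isHermitian_supportPow σ s).eq] at this

/-- Conjugating `1 ± W ≥ 0` by `T` gives `± T W T ≤ T T`. -/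
theorem abs_re_diag_conj_le {T W U : Matrix n n ℂ} (hT : T.IsHermitian)
    (hW : (1 - W).PosSemidef) (hW' : (1 + W).PosSemidef) (i : n) :
    |((star U * (T * W * T) * U) i i).re| ≤ ((star U * (T * T) * U) i i).re := by
  have key : ∀ Z : Matrix n n ℂ, Z.PosSemidef → 0 ≤ ((star U * (T * Z * T) * U) i i).re := by
    intro Z hZ
    have h := (hZ.conjTranspose_mul_mul_same (T * U)).diag_nonneg (i := i)
    rw [conjTranspose_mul, hT.eq, ← star_eq_conjTranspose U] at h
    have e : star U * T * Z * (T * U) = star U * (T * Z * T) * U := by simp only [mul_assoc]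
    rw [e] at h
    exact (Complex.nonneg_iff.mp h).1
  have h1 := key _ hW
  have h2 := key _ hW'
  simp only [mul_add, add_mul, mul_sub, sub_mul, mul_one, add_apply, sub_apply, Complex.add_re,
    Complex.sub_re] at h1 h2
  exact abs_le.mpr ⟨by linarith, by linarith⟩

/-- The `α`-norm of `σ ^ ((1 - α) / (2 α)) X σ ^ ((1 - α) / (2 α))` bounds the pairing of `X`
with every Hermitian contraction. -/
theorem PosSemidef.re_trace_mul_le_alphaNorm {X σ W : Matrix n n ℂ} (hX : X.IsHermitian)
    (hσ : σ.PosSemidef) (hσ1 : σ.trace = 1) (hsupp : matrixSupport X ≤ matrixSupport σ)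
    (hW : (1 - W).PosSemidef) (hW' : (1 + W).PosSemidef) {α : ℝ≥0∞} (hα : 1 ≤ α) :
    (X * W).trace.re ≤ alphaNorm α
      (supportPow σ (sandwichExponent α) * X * supportPow σ (sandwichExponent α)) := by
  set s := sandwichExponent α with hs
  have hαr : α ≠ ⊤ → 1 ≤ α.toReal := fun h => by
    simpa using ENNReal.toReal_mono h hα
  have hs' : -(2 * s) = if α = ⊤ then 1 else (α.toReal - 1) / α.toReal := by
    rw [hs, sandwichExponent]
    split_ifs with h
    · norm_num
    · have := hαr h
      field_simp
      ring
  have hs0 : 0 ≤ -(2 * s) ∧ -(2 * s) ≤ 1 := by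
    rw [hs']
    split_ifs with h
    · norm_num
    · have := hαr h
      exact ⟨div_nonneg (by linarith) (by linarith), (div_le_one (by linarith)).2 (by linarith)⟩
  set Y := supportPow σ s * X * supportPow σ s with hYdef
  have hY : Y.IsHermitian := isHermitian_supportPow_mul_mul hX σ s
  set T := supportPow σ (-s) with hT
  have hXP := hσ.mul_supportPow_zero hsupp
  have hPX : supportPow σ 0 * X = X := by
    have := congrArg (fun M : Matrix n n ℂ => Mᴴ) hXP
    simpa only [conjTranspose_mul, hX.eq, (isHermitian_supportPow σ 0).eq] using this
  -- The sandwich is undone up to the support projection, which `X` absorbs by `hsupp`.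
  have hTY : T * Y * T = X := by
    have : T * Y * T = (T * supportPow σ s) * X * (supportPow σ s * T) := by
      simp only [hYdef, mul_assoc]
    rw [this, hT, hσ.supportPow_mul, hσ.supportPow_mul, neg_add_cancel, add_neg_cancel, hPX, hXP]
  have hTT : T * T = supportPow σ (-(2 * s)) := by
    rw [hT, hσ.supportPow_mul]
    ring_nf
  set U : Matrix n n ℂ := (hY.eigenvectorUnitary : Matrix n n ℂ) with hU
  have hUmem : U ∈ unitaryGroup n ℂ := hY.eigenvectorUnitary.2
  have htr : (X * W).trace = (Y * (T * W * T)).trace := by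
    conv_lhs => rw [← hTY, mul_assoc, mul_assoc, trace_mul_comm]
    simp only [mul_assoc]
  -- The outcome distribution of `σ` measured in the eigenbasis of `Y`.
  set q : n → ℝ := fun i => ((star U * σ * U) i i).re with hq
  have hq0 : ∀ i, 0 ≤ q i := fun i =>
    (Complex.nonneg_iff.mp (hσ.conjTranspose_mul_mul_same U).diag_nonneg).1
  have hq1 : ∑ i, q i = 1 := by
    have : (star U * σ * U).trace = 1 := by
      rw [trace_mul_comm, ← mul_assoc, mem_unitaryGroup_iff.mp hUmem, one_mul, hσ1]
    simpa [trace, Complex.re_sum] using congrArg Complex.re this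
  have main : (X * W).trace.re ≤ ∑ i, |hY.eigenvalues i| * q i ^ (-(2 * s)) := by
    rw [htr, hY.trace_mul_eq_sum, Complex.re_sum]
    refine Finset.sum_le_sum fun i _ => ?_
    rw [Complex.re_ofReal_mul]
    refine (le_abs_self _).trans ?_
    rw [abs_mul]
    refine mul_le_mul_of_nonneg_left ?_ (abs_nonneg _)
    refine (abs_re_diag_conj_le (isHermitian_supportPow σ (-s)) hW hW' i).trans ?_
    rw [← hT, hTT]
    exact hσ.diag_conj_supportPow_le hUmem hs0.1 hs0.2 i
  refine main.trans ?_
  rw [hs']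
  split_ifs with h
  · rw [alphaNorm, if_pos h]
    simp only [Real.rpow_one]
    calc ∑ i, |hY.eigenvalues i| * q i
        ≤ ∑ i, ‖toEuclideanCLM (n := n) (𝕜 := ℂ) Y‖ * q i :=
          Finset.sum_le_sum fun i _ =>
            mul_le_mul_of_nonneg_right (hY.abs_eigenvalues_le_norm i) (hq0 i)
      _ = ‖toEuclideanCLM (n := n) (𝕜 := ℂ) Y‖ := by rw [← Finset.mul_sum, hq1, mul_one]
  · rw [hY.alphaNorm_eq h]
    exact Real.sum_mul_rpow_le_Lp (fun i => abs_nonneg _) hq0 hq1 (hαr h)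

/-- If `X` commutes with `σ` and `|X| = c σ`, then
`‖σ ^ ((1 - α) / (2 α)) X σ ^ ((1 - α) / (2 α))‖_α` is at most `c`. -/
theorem PosSemidef.alphaNorm_le_of_mul_self_eq {X σ : Matrix n n ℂ} (hX : X.IsHermitian)
    (hσ : σ.PosSemidef) (hσ1 : σ.trace = 1) (hcomm : Commute σ X) {c : ℝ} (hc : 0 ≤ c)
    (hXX : X * X = (c ^ 2) • (σ * σ)) {α : ℝ≥0∞} (hα : 1 ≤ α) :
    alphaNorm α
      (supportPow σ (sandwichExponent α) * X * supportPow σ (sandwichExponent α)) ≤ c := by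
  set s := sandwichExponent α with hs
  set Y := supportPow σ s * X * supportPow σ s with hYdef
  have hY : Y.IsHermitian := isHermitian_supportPow_mul_mul hX σ s
  have hSX : Commute (supportPow σ s) X := IsSelfAdjoint.commute_cfc hσ.1 hcomm _
  have hYY : Yᴴ * Y = (c ^ 2) • supportPow σ (4 * s + 2) := by
    have e : Y * Y = (supportPow σ s * supportPow σ s) * (supportPow σ s * supportPow σ s)
        * (X * X) := by
      rw [hYdef]
      have h1 := hSX.eq
      generalize supportPow σ s = S at h1 ⊢
      have h2 : S * X * S = S * S * X := by rw [mul_assoc, ← h1, mul_assoc]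
      have h3 : Commute (S * S) X := Commute.mul_left h1 h1
      rw [h2, mul_assoc (S * S), ← mul_assoc X, ← h3.eq]
      simp only [mul_assoc]
    rw [hY.eq, e, hXX]
    conv_lhs => enter [2, 2]; rw [← hσ.supportPow_one]
    rw [mul_smul_comm]
    simp only [hσ.supportPow_mul]
    ring_nf
  by_cases h : α = ⊤
  · rw [alphaNorm, if_pos h]
    -- At `α = ∞` only `c²` times the support projection remains, and a projection has norm at most
    -- 1.
    have hs2 : 4 * s + 2 = 0 := by rw [hs, sandwichExponent, if_pos h]; norm_num
    rw [hs2] at hYY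
    have hP : ‖toEuclideanCLM (n := n) (𝕜 := ℂ) (supportPow σ 0)‖ ≤ 1 := by
      have h1 := CStarRing.norm_star_mul_self
        (x := toEuclideanCLM (n := n) (𝕜 := ℂ) (supportPow σ 0))
      rw [← map_star, ← map_mul, star_eq_conjTranspose, (isHermitian_supportPow σ 0).eq,
        hσ.supportPow_mul, add_zero] at h1
      nlinarith [norm_nonneg (toEuclideanCLM (n := n) (𝕜 := ℂ) (supportPow σ 0))]
    have h2 := CStarRing.norm_star_mul_self (x := toEuclideanCLM (n := n) (𝕜 := ℂ) Y)
    rw [← map_star, ← map_mul, star_eq_conjTranspose, hYY, ← Complex.coe_smul, map_smul,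
      norm_smul, Complex.norm_real, Real.norm_of_nonneg (sq_nonneg c), ← sq] at h2
    refine le_of_sq_le_sq ?_ hc
    rw [← h2]
    exact mul_le_of_le_one_right (sq_nonneg c) hP
  · have hp : 1 ≤ α.toReal := by simpa using ENNReal.toReal_mono h hα
    -- Here `4 s + 2 = 2 / α`, so `|Y| ^ α = c ^ α σ`, whose trace is `c ^ α`.
    have hs2 : (4 * s + 2) / 2 * α.toReal = 1 := by
      rw [hs, sandwichExponent, if_neg h]
      field_simp
      ring
    have hσ' : IsSelfAdjoint σ := hσ.1
    rw [alphaNorm, if_neg h, matrixAbs, hYY, supportPow, ← cfc_const_mul _ _ σ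
      (continuousOn_spectrum _ _), ← cfc_comp' _ _ σ
      ((σ.finite_real_spectrum.image _).continuousOn _) (continuousOn_spectrum _ _),
      ← cfc_comp' _ _ σ
      ((σ.finite_real_spectrum.image _).continuousOn _) (continuousOn_spectrum _ _)]
    have e : cfc (fun x : ℝ => √(c ^ 2 * if x = 0 then 0 else x ^ (4 * s + 2)) ^ α.toReal) σ
        = (c ^ α.toReal) • σ := by
      rw [← cfc_const_mul_id (R := ℝ) _ σ hσ']
      refine cfc_congr fun x hx => ?_
      have hx0 := hσ.spectrum_nonneg hx
      by_cases h0 : x = 0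
      · simp [h0, Real.zero_rpow (by linarith : α.toReal ≠ 0)]
      · simp only [if_neg h0]
        rw [Real.sqrt_mul (sq_nonneg c), Real.sqrt_sq hc, Real.mul_rpow hc (Real.sqrt_nonneg _),
          Real.sqrt_eq_rpow, ← Real.rpow_mul hx0, ← Real.rpow_mul hx0, mul_one_div, hs2,
          Real.rpow_one]
    rw [e, trace_smul, hσ1, Complex.smul_re, Complex.one_re, smul_eq_mul, mul_one,
      ← Real.rpow_mul hc, mul_one_div, div_self (by linarith), Real.rpow_one]

end Matrix

/-! ### Matching bounds determine the negativity -/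

section LogNegativity

variable {a b : Type*} [Fintype a] [DecidableEq a] [Fintype b] [DecidableEq b]

/-- A witness `W` for the lower bound and a state `σ` for the upper bound determine the
`α`-logarithmic negativity. -/
theorem logNegativity_eq_logb {ρ σ W : Matrix (a × b) (a × b) ℂ} {α : ℝ≥0∞} (hα : 1 ≤ α)
    {c : ℝ} (hc : 0 < c) (hX : (partialTranspose ρ).IsHermitian)
    (hW : (1 - W).PosSemidef) (hW' : (1 + W).PosSemidef)
    (htr : (partialTranspose ρ * W).trace.re = c) (hσ : σ ∈ pptStates a b)
    (hcomm : Commute σ (partialTranspose ρ))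
    (hXX : partialTranspose ρ * partialTranspose ρ = (c ^ 2) • (σ * σ)) :
    logNegativity α ρ = ((Real.logb 2 c : ℝ) : EReal) := by
  have hlog : (0 : EReal) ≤ ((Real.log 2 : ℝ) : EReal) :=
    EReal.coe_nonneg.2 (Real.log_nonneg one_le_two)
  have hc' : ((Real.logb 2 c : ℝ) : EReal) =
      ENNReal.log (ENNReal.ofReal c) / ((Real.log 2 : ℝ) : EReal) := by
    rw [ENNReal.log_ofReal_of_pos hc, ← EReal.coe_div, Real.logb]
  rw [logNegativity, hc']
  apply le_antisymm
  · refine (iInf₂_le σ hσ).trans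
      (EReal.div_le_div_right_of_nonneg hlog (ENNReal.log_monotone ?_))
    have hsupp : matrixSupport (partialTranspose ρ) ≤ matrixSupport σ := by
      rw [Matrix.matrixSupport_le_iff]
      intro v hv
      -- `X† X = c² σ²` forces the kernel of `σ` into that of `X`, so `μ_α` is finite at `σ`.
      have h : ((partialTranspose ρ).conjTranspose * partialTranspose ρ).mulVec v = 0 := by
        rw [hX.eq, hXX, Matrix.smul_mulVec, ← Matrix.mulVec_mulVec, hv, Matrix.mulVec_zero,
          smul_zero]
      exact (Matrix.conjTranspose_mul_self_mulVec_eq_zero _ _).1 h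
    rw [muAlpha, if_pos hsupp]
    exact ENNReal.ofReal_le_ofReal
      (hσ.1.alphaNorm_le_of_mul_self_eq hX hσ.2.2 hcomm hc.le hXX hα)
  · refine le_iInf₂ fun τ hτ =>
      EReal.div_le_div_right_of_nonneg hlog (ENNReal.log_monotone ?_)
    rw [muAlpha]
    split_ifs with h
    · rw [← htr]
      exact ENNReal.ofReal_le_ofReal
        (Matrix.PosSemidef.re_trace_mul_le_alphaNorm hX hτ.1 hτ.2.2 h hW hW' hα)
    · exact le_top

end LogNegativity

/-! ### Weighted swaps and their absolute values -/

namespace Matrix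

/-- For an involution `(1 - W)² = 2 (1 - W)`, so `1 - W` is half of a square. -/
theorem PosSemidef.one_sub_of_mul_self_eq_one {n : Type*} [Fintype n] [DecidableEq n]
    {W : Matrix n n ℂ} (hW : W.IsHermitian) (hWW : W * W = 1) : (1 - W).PosSemidef := by
  have h : ((1 / 2 : ℝ) • ((1 - W)ᴴ * (1 - W))).PosSemidef :=
    (posSemidef_conjTranspose_mul_self (1 - W)).smul (by norm_num)
  convert h using 1
  rw [conjTranspose_sub, conjTranspose_one, hW.eq, sub_mul, mul_sub, mul_sub, hWW, one_mul,
    mul_one, one_mul]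
  module

end Matrix

/-- The two-qubit swap operator, weighted by `x` on `|00⟩, |11⟩` and by `y` on `|01⟩, |10⟩`. -/
noncomputable def weightedSwap (x y : ℝ) : Matrix (Fin 2 × Fin 2) (Fin 2 × Fin 2) ℂ :=
  Matrix.of fun p q => if p = q.swap then (if p.1 = p.2 then (x : ℂ) else (y : ℂ)) else 0

/-- The diagonal matrix with entry `x` on `|00⟩, |11⟩` and `y` on `|01⟩, |10⟩`. -/
noncomputable def weightedDiagonal (x y : ℝ) : Matrix (Fin 2 × Fin 2) (Fin 2 × Fin 2) ℂ :=
  Matrix.diagonal fun p => if p.1 = p.2 then (x : ℂ) else (y : ℂ)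

theorem isHermitian_weightedSwap (x y : ℝ) : (weightedSwap x y).IsHermitian := by
  ext p q
  fin_cases p <;> fin_cases q <;> simp [weightedSwap, Matrix.conjTranspose_apply]

theorem weightedSwap_mul_weightedSwap (x y x' y' : ℝ) :
    weightedSwap x y * weightedSwap x' y' = weightedDiagonal (x * x') (y * y') := by
  ext p q
  fin_cases p <;> fin_cases q <;>
    simp [weightedSwap, weightedDiagonal, Matrix.mul_apply]

theorem commute_weightedDiagonal_weightedSwap (x y x' y' : ℝ) :
    Commute (weightedDiagonal x y) (weightedSwap x' y') := by
  ext p q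
  fin_cases p <;> fin_cases q <;>
    simp [weightedSwap, weightedDiagonal, mul_comm]

theorem weightedDiagonal_mul_weightedDiagonal (x y x' y' : ℝ) :
    weightedDiagonal x y * weightedDiagonal x' y' = weightedDiagonal (x * x') (y * y') := by
  rw [weightedDiagonal, weightedDiagonal, Matrix.diagonal_mul_diagonal, weightedDiagonal]
  congr 1
  ext p
  split_ifs <;> simp

theorem weightedDiagonal_one_one : weightedDiagonal 1 1 = 1 := by
  simp [weightedDiagonal]

theorem smul_weightedDiagonal (r x y : ℝ) :
    r • weightedDiagonal x y = weightedDiagonal (r * x) (r * y) := by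
  rw [weightedDiagonal, ← Matrix.diagonal_smul, weightedDiagonal]
  congr 1
  ext p
  simp only [Pi.smul_apply]
  split_ifs <;> simp

theorem trace_weightedDiagonal (x y : ℝ) :
    (weightedDiagonal x y).trace = ((2 * (x + y) : ℝ) : ℂ) := by
  simp [weightedDiagonal, Matrix.trace, Fintype.sum_prod_type]
  ring

theorem posSemidef_weightedDiagonal {x y : ℝ} (hx : 0 ≤ x) (hy : 0 ≤ y) :
    (weightedDiagonal x y).PosSemidef := by
  refine Matrix.PosSemidef.diagonal fun p => ?_
  dsimp only [Pi.zero_apply]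
  split_ifs
  · exact Complex.zero_le_real.2 hx
  · exact Complex.zero_le_real.2 hy

theorem partialTranspose_weightedDiagonal (x y : ℝ) :
    partialTranspose (weightedDiagonal x y) = weightedDiagonal x y := by
  ext p q
  fin_cases p <;> fin_cases q <;> simp [weightedDiagonal, partialTranspose]

theorem weightedDiagonal_mem_pptStates {x y : ℝ} (hx : 0 ≤ x) (hy : 0 ≤ y)
    (h : 2 * (x + y) = 1) : weightedDiagonal x y ∈ pptStates (Fin 2) (Fin 2) := by
  refine ⟨posSemidef_weightedDiagonal hx hy, ?_, ?_⟩
  · rw [partialTranspose_weightedDiagonal]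
    exact posSemidef_weightedDiagonal hx hy
  · rw [trace_weightedDiagonal, h, Complex.ofReal_one]

theorem logNegativity_of_partialTranspose_eq_weightedSwap
    {ρ : Matrix (Fin 2 × Fin 2) (Fin 2 × Fin 2) ℂ} {x y : ℝ} (hx : 0 ≤ x) (hy : 0 ≤ y)
    (hxy : 0 < x + y) (hρ : partialTranspose ρ = weightedSwap x y) {α : ℝ≥0∞} (hα : 1 ≤ α) :
    logNegativity α ρ = ((Real.logb 2 (2 * (x + y)) : ℝ) : EReal) := by
  have hc : 0 < 2 * (x + y) := by linarith
  have hW := isHermitian_weightedSwap 1 1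
  have hWW : weightedSwap 1 1 * weightedSwap 1 1 = 1 := by
    rw [weightedSwap_mul_weightedSwap, mul_one, weightedDiagonal_one_one]
  -- Since `X = weightedDiagonal x y * W` with `W` the swap, `|X|` is that diagonal matrix; `σ` is
  -- `|X|` divided by its trace `2 (x + y)`.
  refine logNegativity_eq_logb (W := weightedSwap 1 1)
    (σ := weightedDiagonal (x / (2 * (x + y))) (y / (2 * (x + y)))) hα hc
    (hρ ▸ isHermitian_weightedSwap x y)
    (Matrix.PosSemidef.one_sub_of_mul_self_eq_one hW hWW) ?_ ?_ ?_ ?_ ?_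
  · have h := Matrix.PosSemidef.one_sub_of_mul_self_eq_one hW.neg (by rw [neg_mul_neg, hWW])
    rwa [sub_neg_eq_add] at h
  · rw [hρ, weightedSwap_mul_weightedSwap, trace_weightedDiagonal, Complex.ofReal_re, mul_one,
      mul_one]
  · refine weightedDiagonal_mem_pptStates (by positivity) (by positivity) ?_
    field_simp
  · rw [hρ]
    exact commute_weightedDiagonal_weightedSwap _ _ _ _
  · rw [hρ, weightedSwap_mul_weightedSwap, weightedDiagonal_mul_weightedDiagonal,
      smul_weightedDiagonal]
    congr 1 <;> field_simp

/-! ### The three states and the failure of convexity -/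

theorem maxEntangled_two_apply (p q : Fin 2 × Fin 2) :
    maxEntangled 2 p q = if p.1 = p.2 ∧ q.1 = q.2 then 1 / 2 else 0 := by
  fin_cases p <;> fin_cases q <;>
    simp [maxEntangled, Matrix.kroneckerMap_apply]

theorem classicallyCorrelated_eq : classicallyCorrelated = weightedDiagonal (1 / 2) 0 := by
  ext p q
  fin_cases p <;> fin_cases q <;>
    simp [classicallyCorrelated, weightedDiagonal]

theorem equalMixture_eq :
    equalMixture = (1 / 2 : ℝ) • maxEntangled 2 + (1 - 1 / 2 : ℝ) • classicallyCorrelated := by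
  rw [equalMixture, smul_add]
  norm_num

theorem partialTranspose_maxEntangled_two :
    partialTranspose (maxEntangled 2) = weightedSwap (1 / 2) (1 / 2) := by
  ext p q
  rw [partialTranspose, Matrix.of_apply, maxEntangled_two_apply]
  fin_cases p <;> fin_cases q <;> simp [weightedSwap]

/-- The swap fixes `|00⟩` and `|11⟩`, so with zero weight elsewhere the diagonal matrix and the
weighted swap coincide. -/
theorem partialTranspose_classicallyCorrelated :
    partialTranspose classicallyCorrelated = weightedSwap (1 / 2) 0 := by
  rw [classicallyCorrelated_eq, partialTranspose_weightedDiagonal]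
  ext p q
  fin_cases p <;> fin_cases q <;> simp [weightedDiagonal, weightedSwap]

theorem partialTranspose_equalMixture :
    partialTranspose equalMixture = weightedSwap (1 / 2) (1 / 4) := by
  have h : partialTranspose equalMixture = (1 / 2 : ℝ) • partialTranspose (maxEntangled 2) +
      (1 - 1 / 2 : ℝ) • partialTranspose classicallyCorrelated := by
    rw [equalMixture_eq]
    rfl
  rw [h, partialTranspose_maxEntangled_two, partialTranspose_classicallyCorrelated]
  ext p q
  fin_cases p <;> fin_cases q <;> simp [weightedSwap] <;> norm_num

theorem maxEntangled_two_mem_quantumStates : maxEntangled 2 ∈ quantumStates (Fin 2 × Fin 2) := by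
  constructor
  · have h := (Matrix.posSemidef_vecMulVec_self_star
      (fun p : Fin 2 × Fin 2 => if p.1 = p.2 then (1 : ℂ) else 0)).smul
      (show (0 : ℝ) ≤ 1 / 2 by norm_num)
    convert h using 1
    ext p q
    rw [maxEntangled_two_apply]
    fin_cases p <;> fin_cases q <;> simp [Matrix.vecMulVec_apply]
  · simp [Matrix.trace, Fintype.sum_prod_type, maxEntangled_two_apply]

theorem classicallyCorrelated_mem_quantumStates :
    classicallyCorrelated ∈ quantumStates (Fin 2 × Fin 2) := by
  rw [classicallyCorrelated_eq]
  refine ⟨posSemidef_weightedDiagonal (by norm_num) le_rfl, ?_⟩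
  rw [trace_weightedDiagonal]
  norm_num

theorem equalMixture_mem_quantumStates :
    equalMixture ∈ quantumStates (Fin 2 × Fin 2) := by
  obtain ⟨h1, h2⟩ := maxEntangled_two_mem_quantumStates
  obtain ⟨h3, h4⟩ := classicallyCorrelated_mem_quantumStates
  refine ⟨(h1.add h3).smul (by norm_num : (0 : ℝ) ≤ 1 / 2), ?_⟩
  rw [equalMixture, Matrix.trace_smul, Matrix.trace_add, h2, h4, Complex.real_smul]
  norm_num

theorem logNegativity_maxEntangled_two {α : ℝ≥0∞} (hα : 1 ≤ α) :
    logNegativity α (maxEntangled 2) = ((1 : ℝ) : EReal) := by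
  rw [logNegativity_of_partialTranspose_eq_weightedSwap (by norm_num) (by norm_num) (by norm_num)
    partialTranspose_maxEntangled_two hα]
  norm_num

theorem logNegativity_classicallyCorrelated {α : ℝ≥0∞} (hα : 1 ≤ α) :
    logNegativity α classicallyCorrelated = ((0 : ℝ) : EReal) := by
  rw [logNegativity_of_partialTranspose_eq_weightedSwap (by norm_num) le_rfl (by norm_num)
    partialTranspose_classicallyCorrelated hα]
  norm_num

theorem logNegativity_equalMixture {α : ℝ≥0∞} (hα : 1 ≤ α) :
    logNegativity α equalMixture = ((Real.logb 2 (3 / 2) : ℝ) : EReal) := by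
  rw [logNegativity_of_partialTranspose_eq_weightedSwap (by norm_num) (by norm_num) (by norm_num)
    partialTranspose_equalMixture hα]
  norm_num

/-- Equivalent to `(3/2)² = 9/4 > 2`. -/
theorem half_lt_logb_two_three_halves : (1 / 2 : ℝ) < Real.logb 2 (3 / 2) := by
  have h : (1 : ℝ) < 2 * Real.logb 2 (3 / 2) := by
    have h2 : Real.logb 2 ((3 / 2) ^ 2) = 2 * Real.logb 2 (3 / 2) := by
      rw [Real.logb_pow]
      norm_num
    rw [← h2, Real.lt_logb_iff_rpow_lt one_lt_two (by norm_num)]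
    norm_num
  linarith

theorem mainTheorem10 (α : ℝ≥0∞) (hα : 1 ≤ α) :
    (maxEntangled 2 ∈ quantumStates (Fin 2 × Fin 2) ∧
      classicallyCorrelated ∈ quantumStates (Fin 2 × Fin 2) ∧
      equalMixture ∈ quantumStates (Fin 2 × Fin 2)) ∧
    logNegativity α (maxEntangled 2) = ((1 : ℝ) : EReal) ∧
    logNegativity α classicallyCorrelated = ((0 : ℝ) : EReal) ∧
    logNegativity α equalMixture = ((Real.logb 2 (3 / 2) : ℝ) : EReal) ∧
    ((1 / 2 : ℝ) : EReal) *
        (logNegativity α (maxEntangled 2) + logNegativity α classicallyCorrelated) =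
      ((1 / 2 : ℝ) : EReal) ∧
    ((1 / 2 : ℝ) : EReal) *
        (logNegativity α (maxEntangled 2) + logNegativity α classicallyCorrelated) <
      logNegativity α equalMixture ∧
    ¬ ConvexOnStates
      (fun ρ : Matrix (Fin 2 × Fin 2) (Fin 2 × Fin 2) ℂ => logNegativity α ρ) := by
  have h1 := logNegativity_maxEntangled_two hα
  have h2 := logNegativity_classicallyCorrelated hα
  have h3 := logNegativity_equalMixture hα
  have hmean : ((1 / 2 : ℝ) : EReal) *
      (logNegativity α (maxEntangled 2) + logNegativity α classicallyCorrelated) =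
      ((1 / 2 : ℝ) : EReal) := by
    rw [h1, h2, ← EReal.coe_add, ← EReal.coe_mul, add_zero, mul_one]
  refine ⟨⟨maxEntangled_two_mem_quantumStates, classicallyCorrelated_mem_quantumStates,
    equalMixture_mem_quantumStates⟩, h1, h2, h3, hmean, ?_, fun hconv => ?_⟩
  · rw [hmean, h3]
    exact EReal.coe_lt_coe half_lt_logb_two_three_halves
  · have h := hconv _ maxEntangled_two_mem_quantumStates _
      classicallyCorrelated_mem_quantumStates (1 / 2) (by norm_num) (by norm_num)
    dsimp only at h
    rw [← equalMixture_eq, h1, h2, h3, ← EReal.coe_mul, ← EReal.coe_mul, ← EReal.coe_add,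
      EReal.coe_le_coe_iff, mul_one, mul_zero, add_zero] at h
    exact absurd half_lt_logb_two_three_halves (not_lt.2 h)
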